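/- Let $G=(V,E)$ be a finite simple graph drawn in the plane as a 1-plane graph with embedding $\gamma$ (each edge is a simple curve with at most one crossing, and crossings are proper); let $\chi$ be its set of crossings and let $\mathcal G$ be the planarization, the plane graph on $V\cup\chi$ obtained by regarding crossings as vertices. Assume $(G,\gamma)$ is circular: for any two crossing edges $u_1u_3$ and $u_2u_4$ there are vertices $w_1,\dots,w_4$ of degree $2$ in $G$ such that $(u_1,w_1,u_2,w_2,u_3,w_3,u_4,w_4)$ is a cycle of eight crossing-free edges. *Definitions.* They apply to $\mathcal G$ and to the embedding $\gamma|_B$ of a block (maximal biconnected subgraph) $B$ of $\mathcal G$ obtained from the drawing by deleting everything not in $B$; write $H$ for $\mathcal G$ or $B$. Interior and exterior of a cycle are the open regions inside and outside it, so the cycle belongs to neither. Consider cycles $C=(u,c,v,s)$ of $H$ with $u,v\in V$, $c,s\in\chi$. Such a $C$ is a *posi-cycle* if (1) its interior contains neither a crossing-free edge $uv$ nor a crossing other than $c,s$ that is adjacent to both $u$ and $v$; (2) its exterior contains at most one vertex of $V\setminus\{u,v\}$ adjacent to $c$ or $s$ (exactly one: B-cycle; none: W-cycle); and (3) its interior contains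 no face with both $u$ and $v$ on its boundary. It is a *nega-cycle* if (1)–(3) hold with "interior" and "exterior" exchanged. A vertex $z\in V$ is an *in-factor* of a posi-cycle (resp. nega-cycle) $C$ if $H$ has a $z,u$-path and a $z,v$-path all of whose vertices, except the end $u$, resp. $v$, lie in the exterior (resp. interior) of $C$. A pair $\{C,C'\}$ of a posi-cycle $C=(u,c,v,s)$ and a posi- or nega-cycle $C'=(u',c',v',s')$ is a *forbidden cycle pair* in $H$ if $H$ has a $u,u'$-path $P_1$ and a $v,v'$-path $P_2$ such that: if $C'$ is a posi-cycle, then no face lies in the interior of both $C$ and $C'$, and all vertices of $P_1$ other than $u,u'$ and all vertices of $P_2$ other than $v,v'$ lie in the exterior of $C$ and in the exterior of $C'$; if $C'$ is a nega-cycle, then every face in the interior of $C$ is in the interior of $C'$, and all vertices of $P_1$ other than $u,u'$ and all vertices of $P_2$ other than $v,v'$ lie in the exterior of $C$ and in the interior of $C'$. **Lemma.** Suppose that $\mathcal G$ has vertex-connectivity $1$, i.e. is connected and has a cut-vertex. Let $B_1\ne B_2$ be blocks of $\mathcal G$, and let $P_{1,2}$ be a $z_1,z_2$-path of $\mathcal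 G$ with the minimum number of edges, where $z_1,z_2\in V$ and $V(B_i)\cap V(P_{1,2})=\{z_i\}$ for $i=1,2$. If, for each $i=1,2$, $C_i$ is a posi- or nega-cycle of $\gamma|_{B_i}$ to which $z_i$ is an in-factor, then $\{C_1,C_2\}$ is a forbidden cycle pair in $\mathcal G$. -/

import Mathlib

namespace OnePlane

/-- The Euclidean plane. -/
abbrev Plane := EuclideanSpace ℝ (Fin 2)

/-- A drawing of a simple graph in the plane: vertices are distinct points and every edge is a
simple curve between its end-vertices that passes through no other vertex.  The curve of an edge is
parametrized once for each of its two traversal directions (darts). -/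
structure Drawing {V : Type*} (G : SimpleGraph V) where
  pos : V → Plane
  pos_injective : Function.Injective pos
  arc : (d : G.Dart) → Path (pos d.fst) (pos d.snd)
  arc_symm : ∀ (d : G.Dart) (t : unitInterval), arc d.symm t = arc d (unitInterval.symm t)
  arc_injective : ∀ d : G.Dart, Function.Injective (arc d)
  eq_end_of_mem : ∀ (d : G.Dart) (v : V), pos v ∈ Set.range (arc d) → v = d.fst ∨ v = d.snd

namespace Drawing

variable {V : Type*} {G : SimpleGraph V} (D : Drawing G)

/-- The (curves of the) two distinct edges underlying `d` and `d'` share the point `x`, and `x` is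
not a vertex. -/
def CrossAt (d d' : G.Dart) (x : Plane) : Prop :=
  d.edge ≠ d'.edge ∧ x ∈ Set.range (D.arc d) ∧ x ∈ Set.range (D.arc d') ∧ ∀ v : V, x ≠ D.pos v

/-- The curves of `d` and `d'` cross properly at `x` (rather than touch): near `x`, up to a
homeomorphism, they are the two coordinate axes. -/
def ProperAt (d d' : G.Dart) (x : Plane) : Prop :=
  ∃ φ : OpenPartialHomeomorph Plane Plane, x ∈ φ.source ∧ ∀ y ∈ φ.source,
    (y ∈ Set.range (D.arc d) ↔ φ y 1 = 0) ∧ (y ∈ Set.range (D.arc d') ↔ φ y 0 = 0)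

/-- 1-planar drawings: distinct edges meet, apart from common end-vertices, in proper crossings
only, and each edge has at most one crossing. -/
structure IsOnePlanar : Prop where
  proper : ∀ d d' x, D.CrossAt d d' x → D.ProperAt d d' x
  at_most_one : ∀ d d₁ d₂ x₁ x₂, D.CrossAt d d₁ x₁ → D.CrossAt d d₂ x₂ →
    d₁.edge = d₂.edge ∧ x₁ = x₂

/-- The crossings of the drawing. -/
def Crossing : Type := {x : Plane // ∃ d d', D.CrossAt d d' x}

/-- Vertices of the planarization: the vertices of the graph and the crossing-vertices. -/
abbrev PVertex : Type _ := V ⊕ D.Crossing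

/-- The point at which a vertex of the planarization is drawn. -/
def point : D.PVertex → Plane
  | Sum.inl v => D.pos v
  | Sum.inr x => x.1

/-- Adjacency in the planarization of a 1-planar drawing: crossing-free edges between vertices of
the graph, and half-edges between a crossing and the end-vertices of the two edges crossing there.
(Two crossings are never adjacent, as every edge has at most one crossing.) -/
def PAdj : D.PVertex → D.PVertex → Prop
  | Sum.inl u, Sum.inl v =>
      ∃ d : G.Dart, d.fst = u ∧ d.snd = v ∧ ∀ d' x, ¬ D.CrossAt d d' x
  | Sum.inl u, Sum.inr x => ∃ d : G.Dart, d.fst = u ∧ x.1 ∈ Set.range (D.arc d)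
  | Sum.inr x, Sum.inl u => ∃ d : G.Dart, d.fst = u ∧ x.1 ∈ Set.range (D.arc d)
  | Sum.inr _, Sum.inr _ => False

theorem CrossAt.symm_left {d d' : G.Dart} {x : Plane} (h : D.CrossAt d.symm d' x) :
    D.CrossAt d d' x := by
  obtain ⟨h1, h2, h3, h4⟩ := h
  refine ⟨by simpa using h1, ?_, h3, h4⟩
  obtain ⟨t, rfl⟩ := h2
  exact ⟨unitInterval.symm t, (D.arc_symm d t).symm⟩

/-- The planarization. -/
def planarization : SimpleGraph D.PVertex where
  Adj := D.PAdj
  symm := ⟨by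
    rintro (u | x) (v | y) h
    · obtain ⟨d, h1, h2, h3⟩ := h
      exact ⟨d.symm, h2, h1, fun d' x hx => h3 d' x (CrossAt.symm_left D hx)⟩
    · exact h
    · exact h
    · exact h⟩
  loopless := ⟨by
    rintro (u | x) h
    · obtain ⟨d, h1, h2, -⟩ := h
      exact d.fst_ne_snd (h1.trans h2.symm)
    · exact h⟩

/-- The initial part, from `u` to the crossing `x`, of an edge that leaves `u` and passes through
`x`. -/
def halfEdge (u : V) (x : D.Crossing) : Set Plane :=
  {y | ∃ (d : G.Dart) (s t : unitInterval),
    d.fst = u ∧ D.arc d t = x.1 ∧ s ≤ t ∧ D.arc d s = y}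

/-- The curve by which an edge of the planarization is drawn. -/
def curve : D.PVertex → D.PVertex → Set Plane
  | Sum.inl u, Sum.inl v =>
      {y | ∃ d : G.Dart, d.fst = u ∧ d.snd = v ∧ y ∈ Set.range (D.arc d)}
  | Sum.inl u, Sum.inr x => D.halfEdge u x
  | Sum.inr x, Sum.inl u => D.halfEdge u x
  | Sum.inr _, Sum.inr _ => ∅

/-- The point set of the drawing of a subgraph `H` of the planarization, i.e. of the sub-embedding
induced by `H`. -/
def carrier (H : D.planarization.Subgraph) : Set Plane :=
  {y | (∃ a ∈ H.verts, y = D.point a) ∨ ∃ a b, H.Adj a b ∧ y ∈ D.curve a b}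

/-- The faces of the sub-embedding induced by `H`: the connected regions into which the plane is
divided by the drawing of `H`. -/
def IsFace (H : D.planarization.Subgraph) (f : Set Plane) : Prop :=
  ∃ x ∈ (D.carrier H)ᶜ, f = connectedComponentIn (D.carrier H)ᶜ x

/-- Circular instances: the end-vertices `u₁, u₃` and `u₂, u₄` of any two crossing edges lie on
a cycle `(u₁, w₁, u₂, w₂, u₃, w₃, u₄, w₄)` of crossing-free edges, each `wᵢ` having degree 2. -/
def IsCircular : Prop :=
  ∀ (d d' : G.Dart) (x : Plane), D.CrossAt d d' x →
    ∃ w₁ w₂ w₃ w₄ : V,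
      [d.fst, w₁, d'.fst, w₂, d.snd, w₃, d'.snd, w₄].Nodup ∧
      D.planarization.Adj (Sum.inl d.fst) (Sum.inl w₁) ∧
      D.planarization.Adj (Sum.inl w₁) (Sum.inl d'.fst) ∧
      D.planarization.Adj (Sum.inl d'.fst) (Sum.inl w₂) ∧
      D.planarization.Adj (Sum.inl w₂) (Sum.inl d.snd) ∧
      D.planarization.Adj (Sum.inl d.snd) (Sum.inl w₃) ∧
      D.planarization.Adj (Sum.inl w₃) (Sum.inl d'.snd) ∧
      D.planarization.Adj (Sum.inl d'.snd) (Sum.inl w₄) ∧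
      D.planarization.Adj (Sum.inl w₄) (Sum.inl d.fst) ∧
      (∀ w ∈ [w₁, w₂, w₃, w₄], (G.neighborSet w).encard = 2)

/-- A labelled quadruple `(u, c, v, s)` of two distinct vertices and two distinct crossings. -/
structure Quad where
  u : V
  v : V
  c : D.Crossing
  s : D.Crossing
  u_ne_v : u ≠ v
  c_ne_s : c ≠ s

namespace Quad

variable {D}
variable (H : D.planarization.Subgraph) (C : D.Quad)

/-- `(u, c, v, s)` is a cycle of `H`. -/
def IsCycleOf : Prop :=
  H.Adj (Sum.inl C.u) (Sum.inr C.c) ∧ H.Adj (Sum.inr C.c) (Sum.inl C.v) ∧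
  H.Adj (Sum.inl C.v) (Sum.inr C.s) ∧ H.Adj (Sum.inr C.s) (Sum.inl C.u)

/-- The closed curve by which the cycle `(u, c, v, s)` is drawn. -/
def curve : Set Plane :=
  D.halfEdge C.u C.c ∪ D.halfEdge C.v C.c ∪ D.halfEdge C.v C.s ∪ D.halfEdge C.u C.s

/-- The open region enclosed by the cycle. -/
def interior : Set Plane :=
  {x | x ∉ C.curve ∧ Bornology.IsBounded (connectedComponentIn C.curveᶜ x)}

/-- The open region outside the cycle. -/
def exterior : Set Plane :=
  {x | x ∉ C.curve ∧ ¬ Bornology.IsBounded (connectedComponentIn C.curveᶜ x)}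

/-- The faces of `H` in the interior of the cycle. -/
def facesIn : Set (Set Plane) := {f | D.IsFace H f ∧ f ⊆ C.interior}

/-- The side `R` of the cycle contains neither a crossing-free edge `uv` of `H` nor another
crossing-vertex of `H` adjacent to both `u` and `v`. -/
def NoShortcut (R : Set Plane) : Prop :=
  ¬ (H.Adj (Sum.inl C.u) (Sum.inl C.v) ∧
      D.curve (Sum.inl C.u) (Sum.inl C.v) \ {D.pos C.u, D.pos C.v} ⊆ R) ∧
  ∀ c' : D.Crossing, c' ≠ C.c → c' ≠ C.s →
    H.Adj (Sum.inl C.u) (Sum.inr c') → H.Adj (Sum.inl C.v) (Sum.inr c') → c'.1 ∉ R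

/-- The vertices other than `u`, `v` on the side `R` of the cycle that are adjacent to `c`
or `s`. -/
def sideNeighbors (R : Set Plane) : Set V :=
  {x | x ≠ C.u ∧ x ≠ C.v ∧ D.pos x ∈ R ∧
    (H.Adj (Sum.inl x) (Sum.inr C.c) ∨ H.Adj (Sum.inl x) (Sum.inr C.s))}

/-- No face of `H` on the side `R` of the cycle has both `u` and `v` on its boundary. -/
def NoCommonFace (R : Set Plane) : Prop :=
  ¬ ∃ f, D.IsFace H f ∧ f ⊆ R ∧ D.pos C.u ∈ frontier f ∧ D.pos C.v ∈ frontier f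

/-- Candidate posi-cycles of length 4. -/
def IsCandidatePosi : Prop := C.IsCycleOf H ∧ C.NoShortcut H C.interior

/-- Candidate nega-cycles of length 4. -/
def IsCandidateNega : Prop := C.IsCycleOf H ∧ C.NoShortcut H C.exterior

/-- B-cycles of length 4. -/
def IsBCycle : Prop := C.IsCandidatePosi H ∧ (C.sideNeighbors H C.exterior).encard = 1

/-- W-cycles. -/
def IsWCycle : Prop := C.IsCandidatePosi H ∧ C.sideNeighbors H C.exterior = ∅

/-- Posi-cycles, i.e. hard B- or W-cycles (hard cycles have length 4 by definition). -/
def IsPosi : Prop := (C.IsBCycle H ∨ C.IsWCycle H) ∧ C.NoCommonFace H C.interior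

/-- Nega-cycles. -/
def IsNega : Prop :=
  C.IsCandidateNega H ∧ (C.sideNeighbors H C.interior).encard ≤ 1 ∧ C.NoCommonFace H C.exterior

end Quad

/-- `H` has a (simple) path from `a` to `b` all of whose vertices outside `E` lie in the
region `R`. -/
def HasPathIn (H : D.planarization.Subgraph) (R : Set Plane) (a b : D.PVertex)
    (E : Set D.PVertex) : Prop :=
  ∃ p : D.planarization.Walk a b, p.IsPath ∧ p.toSubgraph ≤ H ∧
    ∀ w ∈ p.support, w ∉ E → D.point w ∈ R

namespace Quad

variable {D}
variable (H : D.planarization.Subgraph)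

/-- `C` is a posi- or nega-cycle of `H` to which the vertex `z` is an in-factor: the exterior
(posi-cycle) or interior (nega-cycle) of `C` contains a path from `z` to `u` and one from `z` to
`v`, apart from the last vertices `u` and `v` of these paths. -/
def HasInFactor (C : D.Quad) (z : V) : Prop :=
  (C.IsPosi H ∧
    D.HasPathIn H C.exterior (Sum.inl z) (Sum.inl C.u) {Sum.inl C.u} ∧
    D.HasPathIn H C.exterior (Sum.inl z) (Sum.inl C.v) {Sum.inl C.v}) ∨
  (C.IsNega H ∧
    D.HasPathIn H C.interior (Sum.inl z) (Sum.inl C.u) {Sum.inl C.u} ∧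
    D.HasPathIn H C.interior (Sum.inl z) (Sum.inl C.v) {Sum.inl C.v})

/-- `C = (u, c, v, s)` is a posi-cycle, `C' = (u', c', v', s')` is a posi- or nega-cycle, and there
are a `u,u'`-path and a `v,v'`-path as required for a forbidden cycle pair. -/
def ForbiddenFrom (C C' : D.Quad) : Prop :=
  C.IsPosi H ∧
  ((C'.IsPosi H ∧ Disjoint (C.facesIn H) (C'.facesIn H) ∧
      D.HasPathIn H (C.exterior ∩ C'.exterior) (Sum.inl C.u) (Sum.inl C'.u)
        {Sum.inl C.u, Sum.inl C'.u} ∧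
      D.HasPathIn H (C.exterior ∩ C'.exterior) (Sum.inl C.v) (Sum.inl C'.v)
        {Sum.inl C.v, Sum.inl C'.v}) ∨
    (C'.IsNega H ∧ C.facesIn H ⊆ C'.facesIn H ∧
      D.HasPathIn H (C.exterior ∩ C'.interior) (Sum.inl C.u) (Sum.inl C'.u)
        {Sum.inl C.u, Sum.inl C'.u} ∧
      D.HasPathIn H (C.exterior ∩ C'.interior) (Sum.inl C.v) (Sum.inl C'.v)
        {Sum.inl C.v, Sum.inl C'.v}))

/-- The unordered pair of cycles `C`, `C'`, with the given labellings, is a forbidden cycle pair. -/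
def IsForbiddenPair (C C' : D.Quad) : Prop :=
  ForbiddenFrom H C C' ∨ ForbiddenFrom H C' C

end Quad

end Drawing

/-- A biconnected subgraph: connected, with at least two vertices, and without cut-vertices.
(A single edge counts; it may be a trivial block.) -/
def IsBiconnected {W : Type*} {K : SimpleGraph W} (H : K.Subgraph) : Prop :=
  H.Connected ∧ H.verts.Nontrivial ∧ ∀ w ∈ H.verts, (H.deleteVerts {w}).Connected

/-- Blocks are the maximal biconnected subgraphs. -/
def IsBlock {W : Type*} {K : SimpleGraph W} (B : K.Subgraph) : Prop :=
  Maximal IsBiconnected B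

/-- Vertex-connectivity 1: the graph is connected and has a cut-vertex. -/
def HasConnectivityOne {W : Type*} (K : SimpleGraph W) : Prop :=
  K.Connected ∧ ∃ w : W, ¬ (K.induce ({w}ᶜ : Set W)).Preconnected

end OnePlane

/-! Since `B₁` and `B₂` are distinct blocks, neither can be re-entered from the other: every vertex
of `B₂` and of `P` is reached from `z₁` by a walk meeting `B₁` only in `z₁`, and symmetrically. As
an in-factor, `z₁` lies strictly on one side `R₁` of `C₁`, the exterior for a posi-cycle and the
interior for a nega-cycle. Such a walk avoids `C₁`, so by 1-planarity it cannot change sides; hence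
`P` and all vertices of `B₂` are drawn in `R₁`, and likewise `P` and all vertices of `B₁` in `R₂`.
Joining the in-factor paths through `P` gives the two required paths, and each curve lies on the
prescribed side of the other.

Two things remain. First, posi- and nega-cycles of a block keep their type in the planarization: a
shortcut would be an ear of the block (`NoShortcut.top`), circularity puts all neighbours of a
crossing of the cycle into the block (`sideNeighbors_top`), and faces only get smaller
(`NoCommonFace.top`). Second, the conditions on faces follow from the position of the curves:
mutually exterior curves have disjoint interiors, and otherwise the interiors are nested. Two
nega-cycles would each enclose the other, which is impossible.

A side is a union of bounded or of unbounded components of the complement of the curve, and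
connected sets missing the curve stay on one side; the Jordan curve theorem is not needed. -/

namespace OnePlane

/-! ### Blocks of a graph: ears and walks leaving a block -/

section Blocks

open SimpleGraph

variable {W : Type*} {K : SimpleGraph W}

theorem IsBiconnected.connected_deleteVerts {B : K.Subgraph} (hB : IsBiconnected B) (w : W) :
    (B.deleteVerts {w}).Connected := by
  by_cases hw : w ∈ B.verts
  · exact hB.2.2 w hw
  · rw [← Subgraph.deleteVerts_inter_verts_left_eq, Set.inter_singleton_eq_empty.2 hw,
      Subgraph.deleteVerts_empty]
    exact hB.1

theorem deleteVerts_sup (H H' : K.Subgraph) (s : Set W) :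
    H.deleteVerts s ⊔ H'.deleteVerts s ≤ (H ⊔ H').deleteVerts s :=
  sup_le (Subgraph.deleteVerts_mono le_sup_left) (Subgraph.deleteVerts_mono le_sup_right)

theorem verts_deleteVerts_sup (H H' : K.Subgraph) (s : Set W) :
    (H.deleteVerts s ⊔ H'.deleteVerts s).verts = ((H ⊔ H').deleteVerts s).verts := by
  simp [Set.union_sdiff_distrib]

/-- The union of two biconnected subgraphs with at least two common vertices is biconnected. -/
theorem IsBiconnected.sup {B B' : K.Subgraph} (hB : IsBiconnected B) (hB' : IsBiconnected B')
    (h : (B.verts ∩ B'.verts).Nontrivial) : IsBiconnected (B ⊔ B') := by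
  refine ⟨Subgraph.connected_sup hB.1.preconnected hB'.1.preconnected h.nonempty,
    hB.2.1.mono (Set.subset_union_left), fun w _ => ?_⟩
  -- Of two common vertices, one survives the deletion of `w` and still links the two parts.
  obtain ⟨x, hx, hxw⟩ := h.exists_ne w
  refine (Subgraph.connected_sup (hB.connected_deleteVerts w).preconnected
    (hB'.connected_deleteVerts w).preconnected ⟨x, ?_⟩).mono (deleteVerts_sup _ _ _)
      (verts_deleteVerts_sup _ _ _)
  exact ⟨⟨hx.1, hxw⟩, ⟨hx.2, hxw⟩⟩

/-- The union is biconnected, so maximality makes it equal to both blocks. -/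
theorem IsBlock.eq_of_nontrivial_inter {B B' : K.Subgraph} (hB : IsBlock B) (hB' : IsBlock B')
    (h : (B.verts ∩ B'.verts).Nontrivial) : B = B' :=
  (hB.eq_of_le (hB.prop.sup hB'.prop h) le_sup_left).trans
    (hB'.eq_of_le (hB.prop.sup hB'.prop h) le_sup_right).symm

theorem toSubgraph_le_deleteVerts {H : K.Subgraph} {w a b : W} {p : K.Walk a b}
    (hp : p.toSubgraph ≤ H) (hw : w ∉ p.support) : p.toSubgraph ≤ H.deleteVerts {w} := by
  refine ⟨fun x hx => ⟨hp.1 hx, ?_⟩, fun x y hxy => ?_⟩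
  · rintro rfl
    exact hw (p.mem_verts_toSubgraph.1 hx)
  · have hx := p.mem_verts_toSubgraph.1 (p.toSubgraph.edge_vert hxy)
    have hy := p.mem_verts_toSubgraph.1 (p.toSubgraph.edge_vert hxy.symm)
    rw [Subgraph.deleteVerts_adj]
    refine ⟨H.edge_vert (hp.2 hxy), ?_, H.edge_vert (hp.2 hxy).symm, ?_, hp.2 hxy⟩
    · rintro rfl
      exact hw hx
    · rintro rfl
      exact hw hy

/-- Adding an ear to a biconnected subgraph. -/
theorem IsBiconnected.sup_path {B : K.Subgraph} (hB : IsBiconnected B) {a b : W}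
    (ha : a ∈ B.verts) (hb : b ∈ B.verts) {p : K.Walk a b} (hp : p.IsPath) :
    IsBiconnected (B ⊔ p.toSubgraph) := by
  classical
  refine ⟨Subgraph.connected_sup hB.1.preconnected p.toSubgraph_connected.preconnected
    ⟨a, ha, p.start_mem_verts_toSubgraph⟩, hB.2.1.mono (Set.subset_union_left), fun w _ => ?_⟩
  set M := B ⊔ p.toSubgraph with hM
  have hcon := (Subgraph.connected_iff_forall_exists_walk_subgraph _).1
    (hB.connected_deleteVerts w)
  -- A vertex `x ≠ w` of the ear splits it into two parts sharing only `x`, so at least one part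
  -- avoids `w` and leads from `x` to `B`.
  have key : ∀ x ∈ (M.deleteVerts {w}).verts, ∃ y ∈ (B.deleteVerts {w}).verts,
      ∃ q : K.Walk x y, q.toSubgraph ≤ M.deleteVerts {w} := by
    rintro x ⟨hx | hx, hxw⟩
    · refine ⟨x, ⟨hx, hxw⟩, Walk.nil, ?_⟩
      exact toSubgraph_le_deleteVerts (by simpa [hM] using Or.inl hx) (by simpa using Ne.symm hxw)
    · have hx' := p.mem_verts_toSubgraph.1 hx
      have hsub : (p.takeUntil x hx').toSubgraph ⊔ (p.dropUntil x hx').toSubgraph ≤ M := by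
        rw [← Walk.toSubgraph_append, Walk.take_spec]
        exact le_sup_right
      by_cases hw : w ∈ (p.takeUntil x hx').support
      · have hw' : w ∉ (p.dropUntil x hx').support := fun hw' => by
          have hp' := hp
          rw [← p.take_spec hx'] at hp'
          exact hp'.ne_of_mem_support_of_append (Ne.symm hxw) hw hw' rfl
        refine ⟨b, ⟨hb, ?_⟩, p.dropUntil x hx', toSubgraph_le_deleteVerts
          (le_sup_right.trans hsub) hw'⟩
        rintro rfl
        exact hw' (Walk.end_mem_support _)
      · refine ⟨a, ⟨ha, ?_⟩, (p.takeUntil x hx').reverse, toSubgraph_le_deleteVerts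
          (by rw [Walk.toSubgraph_reverse]; exact le_sup_left.trans hsub) (by simpa using hw)⟩
        rintro rfl
        exact hw (Walk.start_mem_support _)
  have hle : B.deleteVerts {w} ≤ M.deleteVerts {w} := Subgraph.deleteVerts_mono le_sup_left
  refine (Subgraph.connected_iff_forall_exists_walk_subgraph _).2
    ⟨hcon.1.mono hle.1, fun {x y} hx hy => ?_⟩
  obtain ⟨x', hx', q, hq⟩ := key x hx
  obtain ⟨y', hy', r, hr⟩ := key y hy
  obtain ⟨s, hs⟩ := hcon.2 hx' hy'
  refine ⟨(q.append s).append r.reverse, ?_⟩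
  simp only [Walk.toSubgraph_append, Walk.toSubgraph_reverse]
  exact sup_le (sup_le hq (hs.trans hle)) hr

/-- A path between vertices of a block lies in the block. -/
theorem IsBlock.path_le {B : K.Subgraph} (hB : IsBlock B) {a b : W}
    (ha : a ∈ B.verts) (hb : b ∈ B.verts) {p : K.Walk a b} (hp : p.IsPath) :
    p.toSubgraph ≤ B :=
  le_sup_right.trans (hB.2 (hB.prop.sup_path ha hb hp) le_sup_left)

theorem IsBlock.adj {B : K.Subgraph} (hB : IsBlock B) {a b : W}
    (ha : a ∈ B.verts) (hb : b ∈ B.verts) (hab : K.Adj a b) : B.Adj a b := by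
  have hp : (Walk.cons hab Walk.nil).IsPath := by simpa using hab.ne
  exact (hB.path_le ha hb hp).2 (by simp)

/-- A neighbour `x` of a vertex `a` of a block that is joined to another vertex of the block by a
walk avoiding `a` belongs to the block. -/
theorem IsBlock.adj_of_walk {B : K.Subgraph} (hB : IsBlock B) {a b x : W}
    (ha : a ∈ B.verts) (hb : b ∈ B.verts) (hax : K.Adj a x) (q : K.Walk x b)
    (hq : a ∉ q.support) : B.Adj a x := by
  classical
  have hq' : a ∉ q.bypass.support := fun h => hq (q.support_bypass_subset_support h)
  have hp : (Walk.cons hax q.bypass).IsPath := (Walk.cons_isPath_iff _ _).2 ⟨q.bypass_isPath, hq'⟩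
  exact (hB.path_le ha hb hp).2 (by simp)

/-- If a path leads from one of two distinct blocks to the other, meeting each in an end only, then
the blocks have no vertex in common other than that end. -/
theorem IsBlock.eq_of_mem_of_mem {B B' : K.Subgraph} (hB : IsBlock B) (hB' : IsBlock B')
    (hne : B ≠ B') {z z' : W} {p : K.Walk z z'} (hp : p.IsPath)
    (hz : B.verts ∩ {w | w ∈ p.support} = {z}) (hz' : B'.verts ∩ {w | w ∈ p.support} = {z'})
    {y : W} (hy : y ∈ B.verts) (hy' : y ∈ B'.verts) : y = z := by
  classical
  by_contra hyz
  have hzB : z ∈ B.verts := (hz.ge rfl).1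
  have hzB' : z' ∈ B'.verts := (hz'.ge rfl).1
  obtain ⟨q, hq⟩ := ((Subgraph.connected_iff_forall_exists_walk_subgraph _).1 hB'.prop.1).2 hzB' hy'
  have hqv : ∀ w ∈ q.bypass.support, w ∈ B'.verts := fun w hw =>
    hq.1 (q.mem_verts_toSubgraph.2 (q.support_bypass_subset_support hw))
  -- Prolonging `p` inside `B'` to `y` gives a path with both ends in `B`, hence contained in `B`.
  -- So `z'` lies in `B`, which forces `z' = z`, and then `z` and `y` are two common vertices.
  have hpq : (p.append q.bypass).IsPath := by
    rw [Walk.isPath_def, Walk.support_append, List.nodup_append']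
    refine ⟨hp.support_nodup, q.bypass_isPath.support_nodup.tail, fun w hw hw' => ?_⟩
    have : w = z' := hz'.le ⟨hqv w (List.mem_of_mem_tail hw'), hw⟩
    subst this
    have := q.bypass_isPath.support_nodup
    rw [← Walk.cons_tail_support] at this
    exact (List.nodup_cons.1 this).1 hw'
  have hle := hB.path_le hzB hy hpq
  have hz'z : z' = z := hz.le ⟨hle.1 (by simp),
    p.end_mem_support⟩
  subst hz'z
  exact hne (hB.eq_of_nontrivial_inter hB' ⟨z', ⟨hzB, hzB'⟩, y, ⟨hy, hy'⟩, Ne.symm hyz⟩)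

/-- In the situation of `IsBlock.eq_of_mem_of_mem`, each vertex of the second block and of the path
is reached from `z` by a walk that meets the first block in `z` only. -/
theorem IsBlock.exists_walk_inter_eq {B B' : K.Subgraph} (hB : IsBlock B) (hB' : IsBlock B')
    (hne : B ≠ B') {z z' : W} {p : K.Walk z z'} (hp : p.IsPath)
    (hz : B.verts ∩ {w | w ∈ p.support} = {z}) (hz' : B'.verts ∩ {w | w ∈ p.support} = {z'})
    {y : W} (hy : y ∈ B'.verts ∨ y ∈ p.support) :
    ∃ q : K.Walk z y, ∀ w ∈ q.support, w ∈ B.verts → w = z := by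
  classical
  rcases hy with hy | hy
  · have hzB' : z' ∈ B'.verts := (hz'.ge rfl).1
    obtain ⟨q, hq⟩ :=
      ((Subgraph.connected_iff_forall_exists_walk_subgraph _).1 hB'.prop.1).2 hzB' hy
    refine ⟨p.append q, fun w hw hwB => ?_⟩
    rcases (Walk.mem_support_append_iff _ _).1 hw with hw | hw
    · exact hz.le ⟨hwB, hw⟩
    · exact hB.eq_of_mem_of_mem hB' hne hp hz hz' hwB (hq.1 (q.mem_verts_toSubgraph.2 hw))
  · exact ⟨p.takeUntil y hy, fun w hw hwB =>
      hz.le ⟨hwB, p.support_takeUntil_subset_support hy hw⟩⟩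

end Blocks

/-! ### Bounded and unbounded sides of a closed set -/

section Components

variable {X : Type*} [TopologicalSpace X]

/-- A limit point of the component outside `k` can be added to it without losing connectedness, so
it already belongs to it. -/
theorem closure_connectedComponentIn_compl_subset (k : Set X) (x : X) :
    closure (connectedComponentIn kᶜ x) ⊆ connectedComponentIn kᶜ x ∪ k := by
  intro y hy
  by_cases hyk : y ∈ k
  · exact Or.inr hyk
  left
  by_cases hx : x ∈ kᶜ
  · have hpre : IsPreconnected (insert y (connectedComponentIn kᶜ x)) :=
      isPreconnected_connectedComponentIn.subset_closure (Set.subset_insert _ _)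
        (Set.insert_subset hy subset_closure)
    exact hpre.subset_connectedComponentIn (Set.mem_insert_of_mem _ (mem_connectedComponentIn hx))
      (Set.insert_subset hyk (connectedComponentIn_subset _ _)) (Set.mem_insert _ _)
  · rw [connectedComponentIn_eq_empty hx, closure_empty] at hy
    exact hy.elim

/-- Otherwise the component would be clopen, hence the whole space. -/
theorem closure_connectedComponentIn_inter_nonempty [LocallyConnectedSpace X] [PreconnectedSpace X]
    {k : Set X} (hk : IsClosed k) (hne : k.Nonempty) {x : X} (hx : x ∉ k) :
    (closure (connectedComponentIn kᶜ x) ∩ k).Nonempty := by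
  by_contra hemp
  rw [Set.not_nonempty_iff_eq_empty] at hemp
  have hcl : IsClosed (connectedComponentIn kᶜ x) := by
    refine isClosed_of_closure_subset fun y hy => ?_
    rcases closure_connectedComponentIn_compl_subset k x hy with h | h
    · exact h
    · exact absurd (show y ∈ (∅ : Set X) from hemp ▸ ⟨hy, h⟩) (Set.notMem_empty y)
  have huniv := IsClopen.eq_univ ⟨hcl, hk.isOpen_compl.connectedComponentIn⟩
    ⟨x, mem_connectedComponentIn hx⟩
  obtain ⟨y, hy⟩ := hne
  exact connectedComponentIn_subset kᶜ x (huniv ▸ Set.mem_univ y) hy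

/-- The union of the bounded components of the complement of `k`. -/
def inside {E : Type*} [TopologicalSpace E] [Bornology E] (k : Set E) : Set E :=
  {x | x ∉ k ∧ Bornology.IsBounded (connectedComponentIn kᶜ x)}

/-- The union of the unbounded components of the complement of `k`. -/
def outside {E : Type*} [TopologicalSpace E] [Bornology E] (k : Set E) : Set E :=
  {x | x ∉ k ∧ ¬ Bornology.IsBounded (connectedComponentIn kᶜ x)}

/-- `r` is one of the two sides of `k`. -/
def IsSide {E : Type*} [TopologicalSpace E] [Bornology E] (r k : Set E) : Prop :=
  r = inside k ∨ r = outside k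

section

variable {E : Type*} [TopologicalSpace E] [Bornology E] {k k' : Set E}

theorem IsSide.subset_compl {r : Set E} (h : IsSide r k) : r ⊆ kᶜ := by
  rcases h with rfl | rfl <;> exact fun x hx => hx.1

theorem IsSide.subset_of_isPreconnected {r s : Set E} (h : IsSide r k) (hs : IsPreconnected s)
    (hsk : Disjoint s k) {x : E} (hxs : x ∈ s) (hxr : x ∈ r) : s ⊆ r := by
  intro y hy
  have hyk : y ∉ k := Set.disjoint_left.1 hsk hy
  have hc : connectedComponentIn kᶜ x = connectedComponentIn kᶜ y :=
    connectedComponentIn_eq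
      (hs.subset_connectedComponentIn hxs (Set.subset_compl_iff_disjoint_right.2 hsk) hy)
  rcases h with rfl | rfl
  · exact ⟨hyk, hc ▸ hxr.2⟩
  · exact ⟨hyk, hc ▸ hxr.2⟩

variable [LocallyConnectedSpace E] [PreconnectedSpace E]

/-- At a common point, the bounded component of either complement misses the other set, so the two
components coincide. Their closure touches `k`, yet it is contained in the component together with
`k'`, both disjoint from `k`. -/
theorem disjoint_inside_inside (hk : IsClosed k) (hne : k.Nonempty)
    (h : k ⊆ outside k') (h' : k' ⊆ outside k) :
    Disjoint (inside k) (inside k') := by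
  refine Set.disjoint_left.2 fun x hx hx' => ?_
  have aux : ∀ {l l' : Set E}, l' ⊆ outside l → x ∈ inside l →
      connectedComponentIn lᶜ x ⊆ connectedComponentIn l'ᶜ x := by
    intro l l' hl hxl
    refine isPreconnected_connectedComponentIn.subset_connectedComponentIn
      (mem_connectedComponentIn hxl.1) fun y hy hyl => ?_
    exact (hl hyl).2 (connectedComponentIn_eq hy ▸ hxl.2)
  have heq := (aux h' hx).antisymm (aux h hx')
  obtain ⟨y, hy, hyk⟩ := closure_connectedComponentIn_inter_nonempty hk hne hx.1
  rw [heq] at hy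
  rcases closure_connectedComponentIn_compl_subset k' x hy with hy' | hy'
  · rw [← heq] at hy'
    exact connectedComponentIn_subset _ _ hy' hyk
  · exact (h' hy').1 hyk

/-- A component of the complement of `k` that does not meet `k'` lies on the side of `k'` which
contains `k`. -/
theorem IsSide.connectedComponentIn_subset {r : Set E} (hr : IsSide r k') (hk : IsClosed k)
    (hne : k.Nonempty) (h : k ⊆ r) {x : E} (hx : x ∉ k)
    (hd : Disjoint (connectedComponentIn kᶜ x) k') : connectedComponentIn kᶜ x ⊆ r := by
  obtain ⟨y, hy, hyk⟩ := closure_connectedComponentIn_inter_nonempty hk hne hx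
  -- The closure of the component is connected, misses `k'` and meets `k ⊆ r`.
  refine subset_closure.trans (hr.subset_of_isPreconnected
    isPreconnected_connectedComponentIn.closure ?_ hy (h hyk))
  refine Disjoint.mono_left (closure_connectedComponentIn_compl_subset k x) ?_
  exact Set.disjoint_union_left.2 ⟨hd, Set.disjoint_left.2 fun z hz => hr.subset_compl (h hz)⟩

theorem inside_subset_inside (hk : IsClosed k) (hne : k.Nonempty)
    (h : k ⊆ inside k') (h' : k' ⊆ outside k) : inside k ⊆ inside k' := by
  intro x hx
  refine IsSide.connectedComponentIn_subset (Or.inl rfl) hk hne h hx.1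
    (Set.disjoint_left.2 fun y hy hyk => ?_) (mem_connectedComponentIn hx.1)
  exact (h' hyk).2 (connectedComponentIn_eq hy ▸ hx.2)

end

theorem exists_mem_outside {E : Type*} [NormedAddCommGroup E] [NormedSpace ℝ E] [Nontrivial E]
    {k : Set E} (hk : Bornology.IsBounded k) : (outside k).Nonempty := by
  obtain ⟨r, hr, hkr⟩ := hk.subset_ball_lt 0 0
  obtain ⟨e, he⟩ := exists_norm_eq E zero_le_one
  have hnorm : ∀ t ∈ Set.Ici r, ‖t • e‖ = t := fun t ht => by
    rw [norm_smul, he, mul_one, Real.norm_of_nonneg (hr.le.trans ht)]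
  -- A ray starting on the boundary of a ball around `k` is connected, unbounded and misses `k`.
  have hray : (fun t : ℝ => t • e) '' Set.Ici r ⊆ kᶜ := by
    rintro _ ⟨t, ht, rfl⟩ hmem
    have := hkr hmem
    rw [mem_ball_zero_iff, hnorm t ht] at this
    exact absurd this (not_lt.2 ht)
  have hr' : r • e ∈ (fun t : ℝ => t • e) '' Set.Ici r := ⟨r, Set.self_mem_Ici, rfl⟩
  refine ⟨r • e, hray hr', fun hb => ?_⟩
  have hpre : IsPreconnected ((fun t : ℝ => t • e) '' Set.Ici r) :=
    isPreconnected_Ici.image _ (by fun_prop)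
  obtain ⟨C, hC⟩ := (hb.subset (hpre.subset_connectedComponentIn hr' hray)).exists_norm_le
  have h1 := hC _ ⟨max r (C + 1), Set.mem_Ici.2 (le_max_left _ _), rfl⟩
  rw [hnorm _ (Set.mem_Ici.2 (le_max_left _ _))] at h1
  linarith [le_max_right r (C + 1)]

/-- If each set enclosed the other, an unbounded component of `kᶜ` would miss `k'` while its closure
touches `k ⊆ inside k'`. It would then lie in a bounded component of `k'ᶜ`. -/
theorem not_subset_inside_of_subset_inside {E : Type*} [NormedAddCommGroup E] [NormedSpace ℝ E]
    [Nontrivial E] {k k' : Set E} (hk : IsCompact k) (hne : k.Nonempty)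
    (h : k ⊆ inside k') : ¬ k' ⊆ inside k := by
  intro h'
  obtain ⟨x, hx⟩ := exists_mem_outside hk.isBounded
  have hd : Disjoint (connectedComponentIn kᶜ x) k' := Set.disjoint_left.2 fun y hy hyk =>
    hx.2 (connectedComponentIn_eq hy ▸ (h' hyk).2)
  have hsub := IsSide.connectedComponentIn_subset (Or.inl rfl) hk.isClosed hne h hx.1 hd
  have hx' := hsub (mem_connectedComponentIn hx.1)
  exact hx.2 (hx'.2.subset (isPreconnected_connectedComponentIn.subset_connectedComponentIn
    (mem_connectedComponentIn hx.1) (Set.subset_compl_iff_disjoint_right.2 hd)))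

end Components

/-! ### Drawn edges of the planarization: disjointness, connectedness, compactness -/

namespace Drawing

variable {V : Type*} {G : SimpleGraph V} {D : Drawing G}

theorem arc_eq_pos_snd {d : G.Dart} {s : unitInterval} (h : D.arc d s = D.pos d.snd) : s = 1 :=
  D.arc_injective d (h.trans (D.arc d).target.symm)

theorem range_arc_symm (d : G.Dart) : Set.range (D.arc d.symm) = Set.range (D.arc d) := by
  ext y
  constructor
  · rintro ⟨t, rfl⟩
    exact ⟨_, (D.arc_symm d t).symm⟩
  · rintro ⟨t, rfl⟩
    exact ⟨unitInterval.symm t, by rw [D.arc_symm, unitInterval.symm_symm]⟩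

theorem CrossAt.comm {d d' : G.Dart} {x : Plane} (h : D.CrossAt d d' x) : D.CrossAt d' d x :=
  ⟨h.1.symm, h.2.2.1, h.2.1, h.2.2.2⟩

theorem CrossAt.symm_dart {d d' : G.Dart} {x : Plane} (h : D.CrossAt d d' x) :
    D.CrossAt d.symm d' x :=
  ⟨by simpa using h.1, by rw [range_arc_symm]; exact h.2.1, h.2.2⟩

theorem Crossing.ne_pos (x : D.Crossing) (v : V) : x.1 ≠ D.pos v := by
  obtain ⟨_, _, h⟩ := x.2
  exact h.2.2.2 v

/-- Every edge through a crossing crosses another edge there. -/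
theorem Crossing.exists_crossAt (x : D.Crossing) {d : G.Dart} (h : x.1 ∈ Set.range (D.arc d)) :
    ∃ e, D.CrossAt d e x.1 := by
  obtain ⟨e, e', he⟩ := x.2
  by_cases hd : d.edge = e.edge
  · exact ⟨e', by rw [hd]; exact he.1, h, he.2.2⟩
  · exact ⟨e, hd, h, he.2.1, he.2.2.2⟩

theorem IsOnePlanar.crossing_eq (hD : D.IsOnePlanar) {x x' : D.Crossing} {d d' : G.Dart}
    (hx : x.1 ∈ Set.range (D.arc d)) (hx' : x'.1 ∈ Set.range (D.arc d'))
    (h : d.edge = d'.edge) : x = x' := by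
  obtain ⟨e, he⟩ := x.exists_crossAt hx
  obtain ⟨e', he'⟩ := x'.exists_crossAt hx'
  rcases SimpleGraph.dart_edge_eq_iff d d' |>.1 h with rfl | rfl
  · exact Subtype.ext (hD.at_most_one _ _ _ _ _ he he').2
  · exact Subtype.ext (hD.at_most_one _ _ _ _ _ (by simpa using he.symm_dart) he').2

theorem mem_range_of_mem_halfEdge {u : V} {x : D.Crossing} {y : Plane} (h : y ∈ D.halfEdge u x) :
    ∃ d : G.Dart, d.fst = u ∧ x.1 ∈ Set.range (D.arc d) ∧ y ∈ Set.range (D.arc d) := by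
  obtain ⟨d, s, t, h1, h2, -, h4⟩ := h
  exact ⟨d, h1, ⟨t, h2⟩, ⟨s, h4⟩⟩

theorem eq_of_pos_mem_halfEdge {u w : V} {x : D.Crossing} (h : D.pos w ∈ D.halfEdge u x) :
    w = u := by
  obtain ⟨d, s, t, rfl, ht, hst, hs⟩ := h
  rcases D.eq_end_of_mem d w ⟨s, hs⟩ with rfl | rfl
  · rfl
  · obtain rfl := arc_eq_pos_snd hs
    have : t = 1 := le_antisymm unitInterval.le_one' hst
    subst this
    exact absurd (ht.symm.trans (D.arc d).target) (x.ne_pos _)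

/-- A common point that is a vertex must be both `u` and `u'`. Any other common point lies on one
edge, which has a single crossing, or is itself a crossing of two edges and then equals both `x` and
`x'`. -/
theorem disjoint_halfEdge_halfEdge (hD : D.IsOnePlanar) {u u' : V} {x x' : D.Crossing}
    (hu : u ≠ u') (hx : x ≠ x') : Disjoint (D.halfEdge u x) (D.halfEdge u' x') := by
  refine Set.disjoint_left.2 fun y hy hy' => ?_
  by_cases hv : ∃ w, y = D.pos w
  · obtain ⟨w, rfl⟩ := hv
    exact hu ((eq_of_pos_mem_halfEdge hy).symm.trans (eq_of_pos_mem_halfEdge hy'))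
  push Not at hv
  obtain ⟨d, -, hdx, hdy⟩ := mem_range_of_mem_halfEdge hy
  obtain ⟨d', -, hdx', hdy'⟩ := mem_range_of_mem_halfEdge hy'
  by_cases he : d.edge = d'.edge
  · exact hx (hD.crossing_eq hdx hdx' he)
  · have hc : D.CrossAt d d' y := ⟨he, hdy, hdy', hv⟩
    obtain ⟨e, he⟩ := x.exists_crossAt hdx
    obtain ⟨e', he'⟩ := x'.exists_crossAt hdx'
    exact hx (Subtype.ext ((hD.at_most_one _ _ _ _ _ he hc).2.trans
      (hD.at_most_one _ _ _ _ _ hc.comm he').2))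

/-- Edges of the planarization without common end are drawn disjointly. -/
theorem disjoint_curve_halfEdge (hD : D.IsOnePlanar) {a b : D.PVertex} {u : V} {x : D.Crossing}
    (hab : D.planarization.Adj a b) (hau : a ≠ Sum.inl u) (hbu : b ≠ Sum.inl u)
    (hax : a ≠ Sum.inr x) (hbx : b ≠ Sum.inr x) : Disjoint (D.curve a b) (D.halfEdge u x) := by
  rcases a with a | a <;> rcases b with b | b
  · refine Set.disjoint_left.2 ?_
    rintro y ⟨d, rfl, rfl, hdy⟩ hy
    obtain ⟨d', h1, h2, hfree⟩ := hab
    have hdd : d' = d := SimpleGraph.Dart.ext _ _ (Prod.ext h1 h2)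
    subst hdd
    by_cases hv : ∃ w, y = D.pos w
    · obtain ⟨w, rfl⟩ := hv
      obtain rfl := eq_of_pos_mem_halfEdge hy
      rcases D.eq_end_of_mem _ _ hdy with rfl | rfl
      · exact hau rfl
      · exact hbu rfl
    push Not at hv
    obtain ⟨e, -, hex, hey⟩ := mem_range_of_mem_halfEdge hy
    obtain ⟨f, hf⟩ := x.exists_crossAt hex
    -- Either the crossing-free edge is the edge of the half-edge and is crossed at `x`, or it is
    -- crossed at `y`.
    by_cases hE : d'.edge = e.edge
    · rcases (SimpleGraph.dart_edge_eq_iff d' e).1 hE with rfl | rfl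
      · exact hfree _ _ hf
      · exact hfree _ _ hf.symm_dart
    · exact hfree _ _ ⟨hE, hdy, hey, hv⟩
  · exact disjoint_halfEdge_halfEdge hD (fun h => hau (congrArg _ h)) fun h => hbx (congrArg _ h)
  · exact disjoint_halfEdge_halfEdge hD (fun h => hbu (congrArg _ h)) fun h => hax (congrArg _ h)
  · exact hab.elim

theorem pos_mem_halfEdge {u : V} {x : D.Crossing}
    (h : D.planarization.Adj (Sum.inl u) (Sum.inr x)) : D.pos u ∈ D.halfEdge u x := by
  obtain ⟨d, rfl, t, ht⟩ := h
  exact ⟨d, 0, t, rfl, ht, unitInterval.nonneg', (D.arc d).source⟩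

theorem crossing_mem_halfEdge {u : V} {x : D.Crossing}
    (h : D.planarization.Adj (Sum.inl u) (Sum.inr x)) : x.1 ∈ D.halfEdge u x := by
  obtain ⟨d, rfl, t, ht⟩ := h
  exact ⟨d, t, t, rfl, ht, le_rfl, ht⟩

theorem isPreconnected_halfEdge (u : V) (x : D.Crossing) : IsPreconnected (D.halfEdge u x) := by
  refine isPreconnected_of_forall (D.pos u) ?_
  rintro _ ⟨d, s, t, rfl, ht, hst, rfl⟩
  refine ⟨D.arc d '' Set.Iic t, ?_, ⟨0, unitInterval.nonneg', (D.arc d).source⟩,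
    ⟨s, hst, rfl⟩, isPreconnected_Iic.image _ (D.arc d).continuous.continuousOn⟩
  rintro _ ⟨r, hr, rfl⟩
  exact ⟨d, r, t, rfl, ht, hr, rfl⟩

theorem isPreconnected_curve (a b : D.PVertex) : IsPreconnected (D.curve a b) := by
  rcases a with a | a <;> rcases b with b | b
  · refine isPreconnected_of_forall_pair ?_
    rintro y ⟨d, h1, h2, hy⟩ y' ⟨d', h1', h2', hy'⟩
    have hdd : d' = d := SimpleGraph.Dart.ext _ _ (Prod.ext (h1'.trans h1.symm) (h2'.trans h2.symm))
    subst hdd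
    exact ⟨_, fun z hz => ⟨d', h1, h2, hz⟩, hy, hy', isPreconnected_range (D.arc d').continuous⟩
  · exact isPreconnected_halfEdge _ _
  · exact isPreconnected_halfEdge _ _
  · exact isPreconnected_empty

theorem point_left_mem_curve {a b : D.PVertex} (h : D.planarization.Adj a b) :
    D.point a ∈ D.curve a b := by
  rcases a with a | a <;> rcases b with b | b
  · obtain ⟨d, rfl, rfl, -⟩ := h
    exact ⟨d, rfl, rfl, 0, (D.arc d).source⟩
  · exact pos_mem_halfEdge h
  · exact crossing_mem_halfEdge h.symm
  · exact h.elim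

theorem point_right_mem_curve {a b : D.PVertex} (h : D.planarization.Adj a b) :
    D.point b ∈ D.curve a b := by
  rcases a with a | a <;> rcases b with b | b
  · obtain ⟨d, rfl, rfl, -⟩ := h
    exact ⟨d, rfl, rfl, 1, (D.arc d).target⟩
  · exact crossing_mem_halfEdge h
  · exact pos_mem_halfEdge h.symm
  · exact h.elim

/-- A finite union, over the darts leaving `u`, of continuous images of closed subsets of the unit
square. -/
theorem isCompact_halfEdge [Finite V] (u : V) (x : D.Crossing) : IsCompact (D.halfEdge u x) := by
  have : Finite G.Dart := Finite.of_injective _ SimpleGraph.Dart.toProd_injective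
  have heq : D.halfEdge u x = ⋃ d ∈ {d : G.Dart | d.fst = u},
      (fun q : unitInterval × unitInterval => D.arc d q.1) '' {q | D.arc d q.2 = x.1 ∧ q.1 ≤ q.2} := by
    ext y
    simp only [Set.mem_iUnion, Set.mem_image, Prod.exists, exists_prop, Set.mem_ofPred_eq, halfEdge]
    constructor
    · rintro ⟨d, s, t, h1, h2, h3, h4⟩
      exact ⟨d, h1, s, t, ⟨h2, h3⟩, h4⟩
    · rintro ⟨d, h1, s, t, ⟨h2, h3⟩, h4⟩
      exact ⟨d, s, t, h1, h2, h3, h4⟩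
  rw [heq]
  refine (Set.toFinite _).isCompact_biUnion fun d _ => IsCompact.image (IsClosed.isCompact ?_) ?_
  · exact (isClosed_singleton.preimage ((D.arc d).continuous.comp continuous_snd)).inter
      (isClosed_le (α := unitInterval) continuous_fst continuous_snd)
  · exact (D.arc d).continuous.comp continuous_fst

/-! ### The curve of a 4-cycle and its sides -/

namespace Quad

variable (C : D.Quad)

/-- The four vertices of the cycle. -/
def vertexSet : Set D.PVertex := {Sum.inl C.u, Sum.inr C.c, Sum.inl C.v, Sum.inr C.s}

theorem isCompact_curve [Finite V] : IsCompact C.curve :=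
  (((isCompact_halfEdge _ _).union (isCompact_halfEdge _ _)).union (isCompact_halfEdge _ _)).union
    (isCompact_halfEdge _ _)

variable {C}

theorem IsCycleOf.vertexSet_subset {H : D.planarization.Subgraph} (h : C.IsCycleOf H) :
    C.vertexSet ⊆ H.verts := by
  rintro _ (rfl | rfl | rfl | rfl)
  · exact H.edge_vert h.1
  · exact H.edge_vert h.2.1
  · exact H.edge_vert h.2.2.1
  · exact H.edge_vert h.2.2.2

theorem IsCycleOf.mono {H H' : D.planarization.Subgraph} (hH : H ≤ H') (h : C.IsCycleOf H) :
    C.IsCycleOf H' :=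
  ⟨hH.2 h.1, hH.2 h.2.1, hH.2 h.2.2.1, hH.2 h.2.2.2⟩

theorem IsCycleOf.pos_u_mem_curve {H : D.planarization.Subgraph} (h : C.IsCycleOf H) :
    D.pos C.u ∈ C.curve :=
  Or.inl (Or.inl (Or.inl (pos_mem_halfEdge (H.adj_sub h.1))))

theorem IsCycleOf.pos_v_mem_curve {H : D.planarization.Subgraph} (h : C.IsCycleOf H) :
    D.pos C.v ∈ C.curve :=
  Or.inl (Or.inl (Or.inr (pos_mem_halfEdge (H.adj_sub h.2.1).symm)))

theorem IsCycleOf.crossing_mem_curve {H : D.planarization.Subgraph} (h : C.IsCycleOf H) :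
    C.c.1 ∈ C.curve ∧ C.s.1 ∈ C.curve :=
  ⟨Or.inl (Or.inl (Or.inl (crossing_mem_halfEdge (H.adj_sub h.1)))),
    Or.inr (crossing_mem_halfEdge (H.adj_sub h.2.2.2).symm)⟩

/-- Every point of the cycle lies on an edge of the cycle. -/
theorem IsCycleOf.exists_adj_of_mem_curve {H : D.planarization.Subgraph} (h : C.IsCycleOf H)
    {y : Plane} (hy : y ∈ C.curve) : ∃ a ∈ C.vertexSet, ∃ b ∈ C.vertexSet,
      H.Adj a b ∧ y ∈ D.curve a b := by
  rcases hy with ((hy | hy) | hy) | hy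
  · exact ⟨Sum.inl C.u, by simp [vertexSet], Sum.inr C.c, by simp [vertexSet], h.1, hy⟩
  · exact ⟨Sum.inl C.v, by simp [vertexSet], Sum.inr C.c, by simp [vertexSet], h.2.1.symm, hy⟩
  · exact ⟨Sum.inl C.v, by simp [vertexSet], Sum.inr C.s, by simp [vertexSet], h.2.2.1, hy⟩
  · exact ⟨Sum.inl C.u, by simp [vertexSet], Sum.inr C.s, by simp [vertexSet], h.2.2.2.symm, hy⟩

theorem IsCycleOf.curve_subset_carrier {H : D.planarization.Subgraph} (h : C.IsCycleOf H) :
    C.curve ⊆ D.carrier H := fun _ hy => by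
  obtain ⟨a, -, b, -, hab, hy⟩ := h.exists_adj_of_mem_curve hy
  exact Or.inr ⟨a, b, hab, hy⟩

/-- An edge of the planarization without end on the cycle is drawn disjointly from the cycle. -/
theorem disjoint_curve_curve (hD : D.IsOnePlanar) {a b : D.PVertex}
    (hab : D.planarization.Adj a b) (ha : a ∉ C.vertexSet) (hb : b ∉ C.vertexSet) :
    Disjoint (D.curve a b) C.curve := by
  simp only [vertexSet, Set.mem_insert_iff, Set.mem_singleton_iff, not_or] at ha hb
  obtain ⟨ha1, ha2, ha3, ha4⟩ := ha
  obtain ⟨hb1, hb2, hb3, hb4⟩ := hb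
  simp only [curve, Set.disjoint_union_right]
  exact ⟨⟨⟨disjoint_curve_halfEdge hD hab ha1 hb1 ha2 hb2,
    disjoint_curve_halfEdge hD hab ha3 hb3 ha2 hb2⟩,
    disjoint_curve_halfEdge hD hab ha3 hb3 ha4 hb4⟩,
    disjoint_curve_halfEdge hD hab ha1 hb1 ha4 hb4⟩

theorem curve_subset_of_isSide (hD : D.IsOnePlanar) {R : Set Plane} (hR : IsSide R C.curve)
    {a b : D.PVertex} (hab : D.planarization.Adj a b) (ha : a ∉ C.vertexSet)
    (hb : b ∉ C.vertexSet) (haR : D.point a ∈ R) : D.curve a b ⊆ R :=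
  hR.subset_of_isPreconnected (isPreconnected_curve a b) (disjoint_curve_curve hD hab ha hb)
    (point_left_mem_curve hab) haR

/-- A walk that avoids the cycle stays on one side of it. -/
theorem point_mem_of_walk (hD : D.IsOnePlanar) {R : Set Plane} (hR : IsSide R C.curve)
    {a b : D.PVertex} (p : D.planarization.Walk a b) (hp : ∀ w ∈ p.support, w ∉ C.vertexSet)
    (ha : D.point a ∈ R) : D.point b ∈ R := by
  induction p with
  | nil => exact ha
  | cons h p ih =>
    refine ih (fun w hw => hp w (by simp [hw])) ?_
    exact curve_subset_of_isSide hD hR h (hp _ (by simp)) (hp _ (by simp)) ha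
      (point_right_mem_curve h)

theorem isSide_interior : IsSide C.interior C.curve := Or.inl rfl

theorem isSide_exterior : IsSide C.exterior C.curve := Or.inr rfl

theorem IsCycleOf.notMem_vertexSet {H : D.planarization.Subgraph} (h : C.IsCycleOf H)
    {R : Set Plane} (hR : IsSide R C.curve) {a : D.PVertex} (ha : D.point a ∈ R) :
    a ∉ C.vertexSet := by
  rintro (rfl | rfl | rfl | rfl)
  · exact hR.subset_compl ha h.pos_u_mem_curve
  · exact hR.subset_compl ha h.crossing_mem_curve.1
  · exact hR.subset_compl ha h.pos_v_mem_curve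
  · exact hR.subset_compl ha h.crossing_mem_curve.2

end Quad

/-! ### From a block to the planarization: cycle properties, sides and paths -/

open SimpleGraph

/-- In a circular instance, the neighbours of a crossing are joined by walks that avoid it. -/
theorem IsCircular.exists_walk (hD : D.IsOnePlanar) (hcirc : D.IsCircular) (x : D.Crossing)
    {a b : V} (ha : D.planarization.Adj (Sum.inl a) (Sum.inr x))
    (hb : D.planarization.Adj (Sum.inl b) (Sum.inr x)) :
    ∃ q : D.planarization.Walk (Sum.inl a) (Sum.inl b), Sum.inr x ∉ q.support := by
  obtain ⟨e, e', he⟩ := x.2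
  obtain ⟨w₁, w₂, w₃, -, -, h1, h2, h3, h4, h5, h6, -⟩ := hcirc _ _ _ he
  have hsnd : ∃ q : D.planarization.Walk (Sum.inl e.fst) (Sum.inl e.snd),
      Sum.inr x ∉ q.support :=
    ⟨Walk.cons h1 (Walk.cons h2 (Walk.cons h3 (Walk.cons h4 Walk.nil))), by simp⟩
  have hsnd' : ∃ q : D.planarization.Walk (Sum.inl e.fst) (Sum.inl e'.snd),
      Sum.inr x ∉ q.support :=
    ⟨Walk.cons h1 (Walk.cons h2 (Walk.cons h3 (Walk.cons h4 (Walk.cons h5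
      (Walk.cons h6 Walk.nil))))), by simp⟩
  have key : ∀ a : V, D.planarization.Adj (Sum.inl a) (Sum.inr x) →
      ∃ q : D.planarization.Walk (Sum.inl e.fst) (Sum.inl a), Sum.inr x ∉ q.support := by
    rintro _ ⟨d, rfl, hd⟩
    -- A third edge through `x` would be a second edge crossing `e`.
    have hor : d.edge = e.edge ∨ d.edge = e'.edge := by
      by_contra! hne
      exact hne.2 (hD.at_most_one _ _ _ _ _
        (show D.CrossAt e d x.1 from ⟨hne.1.symm, he.2.1, hd, he.2.2.2⟩) he).1
    rcases hor with h | h <;> rcases (dart_edge_eq_iff _ _).1 h with rfl | rfl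
    · exact ⟨Walk.nil, by simp⟩
    · exact hsnd
    · exact ⟨Walk.cons h1 (Walk.cons h2 Walk.nil), by simp⟩
    · exact hsnd'
  obtain ⟨p, hp⟩ := key a ha
  obtain ⟨q, hq⟩ := key b hb
  exact ⟨p.reverse.append q, by simp [Walk.mem_support_append_iff, hp, hq]⟩

namespace Quad

variable {C : D.Quad} {B : D.planarization.Subgraph} {R : Set Plane}

/-- An edge `uv` or a path `u, c', v` has both ends in the block, so it already belongs to the
block. -/
theorem NoShortcut.top (hB : IsBlock B) (hC : C.IsCycleOf B) (h : C.NoShortcut B R) :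
    C.NoShortcut ⊤ R := by
  have hu := B.edge_vert hC.1
  have hv := B.edge_vert hC.2.2.1
  refine ⟨fun huv => h.1 ⟨hB.adj hu hv huv.1, huv.2⟩, fun c' h1 h2 h3 h4 => ?_⟩
  refine h.2 c' h1 h2 (hB.adj_of_walk hu hv h3 (Walk.cons h4.symm Walk.nil) ?_)
    (hB.adj_of_walk hv hu h4 (Walk.cons h3.symm Walk.nil) ?_)
  · simpa using C.u_ne_v
  · simpa using C.u_ne_v.symm

/-- This is where circularity enters: the 8-cycle around a crossing joins its neighbours while
avoiding it, so all half-edges at the crossing lie in one block. Without it the crossing could be a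
cut-vertex. -/
theorem sideNeighbors_top (hD : D.IsOnePlanar) (hcirc : D.IsCircular) (hB : IsBlock B)
    (hC : C.IsCycleOf B) : C.sideNeighbors ⊤ R = C.sideNeighbors B R := by
  have key : ∀ (x : V) (c : D.Crossing), B.Adj (Sum.inl C.u) (Sum.inr c) →
      D.planarization.Adj (Sum.inl x) (Sum.inr c) → B.Adj (Sum.inl x) (Sum.inr c) := by
    intro x c hc hx
    obtain ⟨q, hq⟩ := hcirc.exists_walk hD c hx hc.adj_sub
    exact (hB.adj_of_walk (B.edge_vert hc.symm) (B.edge_vert hc) hx.symm q hq).symm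
  ext x
  refine ⟨fun ⟨h1, h2, h3, h4⟩ => ⟨h1, h2, h3, h4.imp (key x _ hC.1) (key x _ hC.2.2.2.symm)⟩,
    fun ⟨h1, h2, h3, h4⟩ => ⟨h1, h2, h3, h4.imp (fun h => h.adj_sub) fun h => h.adj_sub⟩⟩

/-- A face of the planarization in `R` lies in a face of `B`, which stays in `R` because it misses
the cycle. Points of the cycle on the frontier of the smaller face are limits of the larger one and
do not belong to it, hence lie on its frontier too. -/
theorem NoCommonFace.top (hR : IsSide R C.curve) (hC : C.IsCycleOf B)
    (h : C.NoCommonFace B R) : C.NoCommonFace ⊤ R := by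
  rintro ⟨f, ⟨x, hx, rfl⟩, hfR, hu, hv⟩
  have hsub : (D.carrier ⊤)ᶜ ⊆ (D.carrier B)ᶜ := by
    refine Set.compl_subset_compl.2 ?_
    rintro y (⟨a, -, ha⟩ | ⟨a, b, hab, hy⟩)
    · exact Or.inl ⟨a, trivial, ha⟩
    · exact Or.inr ⟨a, b, hab.adj_sub, hy⟩
  have hle := connectedComponentIn_mono x hsub
  have hxf := mem_connectedComponentIn (hsub hx)
  have hfr : ∀ y ∈ C.curve, y ∈ frontier (connectedComponentIn (D.carrier ⊤)ᶜ x) →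
      y ∈ frontier (connectedComponentIn (D.carrier B)ᶜ x) := fun y hy hyf =>
    ⟨closure_mono hle hyf.1, fun hyi =>
      connectedComponentIn_subset _ _ (interior_subset hyi) (hC.curve_subset_carrier hy)⟩
  refine h ⟨_, ⟨x, hsub hx, rfl⟩, ?_, hfr _ hC.pos_u_mem_curve hu, hfr _ hC.pos_v_mem_curve hv⟩
  refine hR.subset_of_isPreconnected isPreconnected_connectedComponentIn ?_ hxf
    (hfR (mem_connectedComponentIn hx))
  exact Set.disjoint_left.2 fun y hy hyc =>
    connectedComponentIn_subset _ _ hy (hC.curve_subset_carrier hyc)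

theorem IsPosi.isCycleOf (h : C.IsPosi B) : C.IsCycleOf B := by
  rcases h.1 with h | h <;> exact h.1.1

/-- A posi-cycle of a block is a posi-cycle of the planarization. -/
theorem IsPosi.top (hD : D.IsOnePlanar) (hcirc : D.IsCircular) (hB : IsBlock B)
    (h : C.IsPosi B) : C.IsPosi ⊤ := by
  have hC := h.isCycleOf
  refine ⟨h.1.imp (fun h => ⟨⟨hC.mono le_top, h.1.2.top hB hC⟩, ?_⟩)
    (fun h => ⟨⟨hC.mono le_top, h.1.2.top hB hC⟩, ?_⟩), h.2.top isSide_interior hC⟩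
  · rw [sideNeighbors_top hD hcirc hB hC]
    exact h.2
  · rw [sideNeighbors_top hD hcirc hB hC]
    exact h.2

/-- A nega-cycle of a block is a nega-cycle of the planarization. -/
theorem IsNega.top (hD : D.IsOnePlanar) (hcirc : D.IsCircular) (hB : IsBlock B)
    (h : C.IsNega B) : C.IsNega ⊤ := by
  have hC := h.1.1
  refine ⟨⟨hC.mono le_top, h.1.2.top hB hC⟩, ?_, h.2.2.top isSide_exterior hC⟩
  rw [sideNeighbors_top hD hcirc hB hC]
  exact h.2.1

/-- `z` reaches `u` and `v` by paths of `B` in the region `R`. -/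
def ReachedIn (B : D.planarization.Subgraph) (C : D.Quad) (R : Set Plane) (z : V) : Prop :=
  D.HasPathIn B R (Sum.inl z) (Sum.inl C.u) {Sum.inl C.u} ∧
    D.HasPathIn B R (Sum.inl z) (Sum.inl C.v) {Sum.inl C.v}

/-- As `u ≠ v`, the vertex `z` is not the exempt end of at least one of the two paths. -/
theorem ReachedIn.pos_mem {z : V} (h : ReachedIn B C R z) : D.pos z ∈ R := by
  obtain ⟨⟨p, -, -, hp⟩, ⟨q, -, -, hq⟩⟩ := h
  by_cases hz : z = C.u
  · exact hq _ q.start_mem_support (by simpa [hz] using C.u_ne_v)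
  · exact hp _ p.start_mem_support (by simpa using hz)

/-- What a block `B'` and a path `p` from a vertex `z` of the block `B` to `B'` lie on: the side of
the cycle `C` of `B` that contains `z`. -/
theorem IsCycleOf.point_mem_of_block (hD : D.IsOnePlanar) {B' : D.planarization.Subgraph}
    (hB : IsBlock B) (hB' : IsBlock B') (hne : B ≠ B') {z z' : V}
    {p : D.planarization.Walk (Sum.inl z) (Sum.inl z')} (hp : p.IsPath)
    (hz : B.verts ∩ {w | w ∈ p.support} = {Sum.inl z})
    (hz' : B'.verts ∩ {w | w ∈ p.support} = {Sum.inl z'})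
    (hC : C.IsCycleOf B) (hR : IsSide R C.curve) (hzR : D.pos z ∈ R) {y : D.PVertex}
    (hy : y ∈ B'.verts ∨ y ∈ p.support) : D.point y ∈ R := by
  obtain ⟨q, hq⟩ := hB.exists_walk_inter_eq hB' hne hp hz hz' hy
  refine point_mem_of_walk hD hR q (fun w hw hwC => ?_) hzR
  -- The walk could meet the cycle only in `z`, but `z` lies strictly on a side of it.
  have := hq w hw (hC.vertexSet_subset hwC)
  subst this
  exact hC.notMem_vertexSet (a := Sum.inl z) hR hzR hwC

/-- Two cycles of a graph lie on the sides of each other that contain their vertices. -/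
theorem IsCycleOf.curve_subset (hD : D.IsOnePlanar) {C' : D.Quad} {B' : D.planarization.Subgraph}
    (hC : C.IsCycleOf B) (hR : IsSide R C.curve) (hC' : C'.IsCycleOf B')
    (h : ∀ y ∈ B'.verts, D.point y ∈ R) : C'.curve ⊆ R := by
  intro y hy
  obtain ⟨a, -, b, -, hab, hy⟩ := hC'.exists_adj_of_mem_curve hy
  have ha := h a (B'.edge_vert hab)
  have hb := h b (B'.edge_vert hab.symm)
  exact curve_subset_of_isSide hD hR hab.adj_sub (hC.notMem_vertexSet hR ha)
    (hC.notMem_vertexSet hR hb) ha hy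

/-- Paths from `z` to `a` in `B`, from `z` to `z'`, and from `z'` to `a'` in `B'` are joined into
a path from `a` to `a'`. -/
theorem hasPathIn_top_of_concat {B' : D.planarization.Subgraph} {R' : Set Plane}
    {z z' a a' : D.PVertex} {p : D.planarization.Walk z z'}
    (ha : D.HasPathIn B R z a {a}) (ha' : D.HasPathIn B' R' z' a' {a'})
    (hp : ∀ w ∈ p.support, D.point w ∈ R ∩ R')
    (hB : ∀ w ∈ B.verts, D.point w ∈ R') (hB' : ∀ w ∈ B'.verts, D.point w ∈ R) :
    D.HasPathIn ⊤ (R ∩ R') a a' {a, a'} := by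
  classical
  obtain ⟨q, -, hq, hqR⟩ := ha
  obtain ⟨q', -, hq', hqR'⟩ := ha'
  refine ⟨((q.reverse.append p).append q').bypass, Walk.bypass_isPath _, le_top,
    fun w hw hwE => ?_⟩
  have hw' := Walk.support_bypass_subset_support _ hw
  simp only [Set.mem_insert_iff, Set.mem_singleton_iff, not_or] at hwE
  rw [Walk.mem_support_append_iff, Walk.mem_support_append_iff, Walk.support_reverse,
    List.mem_reverse] at hw'
  rcases hw' with (hw' | hw') | hw'
  · exact ⟨hqR w hw' hwE.1, hB w (hq.1 (q.mem_verts_toSubgraph.2 hw'))⟩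
  · exact hp w hw'
  · exact ⟨hB' w (hq'.1 (q'.mem_verts_toSubgraph.2 hw')), hqR' w hw' hwE.2⟩

end Quad

/-! ### Assembling the forbidden cycle pair -/

theorem HasPathIn.symm_pair {H : D.planarization.Subgraph} {R R' : Set Plane} {a b : D.PVertex}
    (h : D.HasPathIn H (R ∩ R') a b {a, b}) : D.HasPathIn H (R' ∩ R) b a {b, a} := by
  obtain ⟨p, hp, hpH, hpR⟩ := h
  refine ⟨p.reverse, hp.reverse, by rwa [Walk.toSubgraph_reverse], fun w hw hwE => ?_⟩
  rw [Set.inter_comm]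
  exact hpR w (by simpa using hw) (by rwa [Set.pair_comm])

namespace Quad

variable {C C' : D.Quad} {B B' : D.planarization.Subgraph}

theorem IsPosi.forbiddenFrom_of_isNega [Finite V] {H : D.planarization.Subgraph}
    (h : C.IsPosi H) (h' : C'.IsNega H) (hCC' : C.curve ⊆ C'.interior)
    (hC'C : C'.curve ⊆ C.exterior)
    (hu : D.HasPathIn H (C.exterior ∩ C'.interior) (Sum.inl C.u) (Sum.inl C'.u)
      {Sum.inl C.u, Sum.inl C'.u})
    (hv : D.HasPathIn H (C.exterior ∩ C'.interior) (Sum.inl C.v) (Sum.inl C'.v)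
      {Sum.inl C.v, Sum.inl C'.v}) : ForbiddenFrom H C C' :=
  ⟨h, Or.inr ⟨h', fun _ hf => ⟨hf.1, hf.2.trans (inside_subset_inside C.isCompact_curve.isClosed
    ⟨_, h.isCycleOf.pos_u_mem_curve⟩ hCC' hC'C)⟩, hu, hv⟩⟩

theorem IsPosi.forbiddenFrom_of_isPosi [Finite V] {H : D.planarization.Subgraph}
    (h : C.IsPosi H) (h' : C'.IsPosi H) (hCC' : C.curve ⊆ C'.exterior)
    (hC'C : C'.curve ⊆ C.exterior)
    (hu : D.HasPathIn H (C.exterior ∩ C'.exterior) (Sum.inl C.u) (Sum.inl C'.u)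
      {Sum.inl C.u, Sum.inl C'.u})
    (hv : D.HasPathIn H (C.exterior ∩ C'.exterior) (Sum.inl C.v) (Sum.inl C'.v)
      {Sum.inl C.v, Sum.inl C'.v}) : ForbiddenFrom H C C' := by
  refine ⟨h, Or.inl ⟨h', ?_, hu, hv⟩⟩
  have hd : Disjoint C.interior C'.interior := disjoint_inside_inside
    C.isCompact_curve.isClosed ⟨_, h.isCycleOf.pos_u_mem_curve⟩ hCC' hC'C
  refine Set.disjoint_left.2 ?_
  rintro _ ⟨⟨x, hx, rfl⟩, hf⟩ ⟨-, hf'⟩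
  -- Faces are nonempty, so one contained in both interiors would contradict their disjointness.
  have hxf := mem_connectedComponentIn hx
  exact Set.disjoint_left.1 hd (hf hxf) (hf' hxf)

end Quad

end Drawing

end OnePlane

open OnePlane OnePlane.Drawing OnePlane.Drawing.Quad in
theorem lemma9 {V : Type*} [Finite V] (G : SimpleGraph V) (D : OnePlane.Drawing G)
    (hD : D.IsOnePlanar) (hcirc : D.IsCircular)
    (hconn : OnePlane.HasConnectivityOne D.planarization)
    (B₁ B₂ : D.planarization.Subgraph)
    (hB₁ : OnePlane.IsBlock B₁) (hB₂ : OnePlane.IsBlock B₂) (hne : B₁ ≠ B₂)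
    (z₁ z₂ : V) (P : D.planarization.Walk (Sum.inl z₁) (Sum.inl z₂))
    (hP : P.IsPath)
    (hmin : ∀ Q : D.planarization.Walk (Sum.inl z₁) (Sum.inl z₂), P.length ≤ Q.length)
    (hP₁ : B₁.verts ∩ {w | w ∈ P.support} = {Sum.inl z₁})
    (hP₂ : B₂.verts ∩ {w | w ∈ P.support} = {Sum.inl z₂})
    (C₁ C₂ : D.Quad)
    (hC₁ : OnePlane.Drawing.Quad.HasInFactor B₁ C₁ z₁)
    (hC₂ : OnePlane.Drawing.Quad.HasInFactor B₂ C₂ z₂) :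
    OnePlane.Drawing.Quad.IsForbiddenPair ⊤ C₁ C₂ := by
  have hsup : ∀ w, w ∈ P.reverse.support ↔ w ∈ P.support := by simp
  -- The argument is the same for all combinations of types; `R₁` and `R₂` are the sides containing
  -- the in-factors.
  have main : ∀ R₁ R₂ : Set Plane, IsSide R₁ C₁.curve → IsSide R₂ C₂.curve →
      C₁.IsCycleOf B₁ → C₂.IsCycleOf B₂ → ReachedIn B₁ C₁ R₁ z₁ → ReachedIn B₂ C₂ R₂ z₂ →
      C₁.curve ⊆ R₂ ∧ C₂.curve ⊆ R₁ ∧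
      D.HasPathIn ⊤ (R₁ ∩ R₂) (Sum.inl C₁.u) (Sum.inl C₂.u) {Sum.inl C₁.u, Sum.inl C₂.u} ∧
      D.HasPathIn ⊤ (R₁ ∩ R₂) (Sum.inl C₁.v) (Sum.inl C₂.v) {Sum.inl C₁.v, Sum.inl C₂.v} := by
    intro R₁ R₂ hR₁ hR₂ hcyc₁ hcyc₂ hr₁ hr₂
    have h₁ : ∀ y, y ∈ B₂.verts ∨ y ∈ P.support → D.point y ∈ R₁ := fun y hy =>
      hcyc₁.point_mem_of_block hD hB₁ hB₂ hne hP hP₁ hP₂ hR₁ hr₁.pos_mem hy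
    have h₂ : ∀ y, y ∈ B₁.verts ∨ y ∈ P.support → D.point y ∈ R₂ := fun y hy =>
      hcyc₂.point_mem_of_block hD hB₂ hB₁ hne.symm hP.reverse (by simpa only [hsup] using hP₂)
        (by simpa only [hsup] using hP₁) hR₂ hr₂.pos_mem (by rwa [hsup])
    have hp : ∀ w ∈ P.support, D.point w ∈ R₁ ∩ R₂ := fun w hw =>
      ⟨h₁ w (Or.inr hw), h₂ w (Or.inr hw)⟩
    exact ⟨hcyc₂.curve_subset hD hR₂ hcyc₁ fun y hy => h₂ y (Or.inl hy),
      hcyc₁.curve_subset hD hR₁ hcyc₂ fun y hy => h₁ y (Or.inl hy),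
      hasPathIn_top_of_concat hr₁.1 hr₂.1 hp (fun y hy => h₂ y (Or.inl hy))
        fun y hy => h₁ y (Or.inl hy),
      hasPathIn_top_of_concat hr₁.2 hr₂.2 hp (fun y hy => h₂ y (Or.inl hy))
        fun y hy => h₁ y (Or.inl hy)⟩
  rcases hC₁ with ⟨h₁, hr₁⟩ | ⟨h₁, hr₁⟩ <;> rcases hC₂ with ⟨h₂, hr₂⟩ | ⟨h₂, hr₂⟩
  · obtain ⟨hs₁, hs₂, hu, hv⟩ := main _ _ isSide_exterior isSide_exterior h₁.isCycleOf
      h₂.isCycleOf hr₁ hr₂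
    exact Or.inl ((h₁.top hD hcirc hB₁).forbiddenFrom_of_isPosi (h₂.top hD hcirc hB₂) hs₁ hs₂
      hu hv)
  · obtain ⟨hs₁, hs₂, hu, hv⟩ := main _ _ isSide_exterior isSide_interior h₁.isCycleOf
      h₂.1.1 hr₁ hr₂
    exact Or.inl ((h₁.top hD hcirc hB₁).forbiddenFrom_of_isNega (h₂.top hD hcirc hB₂) hs₁ hs₂
      hu hv)
  -- The posi-cycle has to come first in the pair, so the roles are exchanged.
  · obtain ⟨hs₁, hs₂, hu, hv⟩ := main _ _ isSide_interior isSide_exterior h₁.1.1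
      h₂.isCycleOf hr₁ hr₂
    exact Or.inr ((h₂.top hD hcirc hB₂).forbiddenFrom_of_isNega (h₁.top hD hcirc hB₁) hs₂ hs₁
      hu.symm_pair hv.symm_pair)
  -- Two nega-cycles cannot occur: each curve would lie in the interior of the other.
  · obtain ⟨hs₁, hs₂, -⟩ := main _ _ isSide_interior isSide_interior h₁.1.1 h₂.1.1 hr₁ hr₂
    exact (not_subset_inside_of_subset_inside C₁.isCompact_curve
      ⟨_, h₁.1.1.pos_u_mem_curve⟩ hs₁ hs₂).elim
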